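/- Let $S$ be a closed, densely defined, non-negative symmetric operator in a complex Hilbert space $\mathfrak H$. For $z\in\mathbb C$ put $$\mathfrak M_{z}:=\operatorname{ran}(S-zI),\qquad \mathfrak N_z:=\mathfrak H\ominus\mathfrak M_{\bar z}=\ker(S^*-zI),$$ and for $z\neq 0$, $\operatorname{Re} z\le 0$, let $S_z$ be the operator $$\operatorname{dom}S_z:=\operatorname{dom}S\dotplus\mathfrak N_z,\qquad S_z(f_S+\varphi_z):=Sf_S-z\varphi_z,\quad f_S\in\operatorname{dom}S,\ \varphi_z\in\mathfrak N_z .$$ Then $\mathfrak M_{\bar z}$ is closed and $S_z$ is an $m$-accretive extension of $S$ for every such $z$. With $P_{\mathfrak L}$ denoting the orthogonal projection onto a closed subspace $\mathfrak L$, and $\operatorname{dom}S^2=\{f\in\operatorname{dom}S: Sf\in\operatorname{dom}S\}$, the following hold. i) If $\operatorname{Re}z<0$, then $$\operatorname{dom}S_z\cap\operatorname{dom}S_z^*=\big(\operatorname{Re}z\,P_{\mathfrak M_{\bar z}}+i\,\operatorname{Im}z\,P_{\mathfrak N_z}\big)\operatorname{dom}S .$$ ii) If $a<0$, then $$\operatorname{dom}S_a\cap\operatorname{dom}S_a^*=P_{\mathfrak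 M_a}\operatorname{dom}S=\operatorname{dom}S_a\cap\mathfrak M_a=\operatorname{dom}S_a^*\cap\mathfrak M_a ;$$ further, $T_a:=P_{\mathfrak M_a}S_a{\upharpoonright}(\operatorname{dom}S_a\cap\mathfrak M_a)$ is selfadjoint and non-negative in the Hilbert space $\mathfrak M_a$, and $T_a=P_{\mathfrak M_a}S_a^*{\upharpoonright}(\operatorname{dom}S_a\cap\mathfrak M_a)$. iii) If $z=ix$ with $x\in\mathbb R\setminus\{0\}$, then $$\operatorname{dom}S_{ix}\cap\operatorname{dom}S_{ix}^*=\big((S+ixI)\operatorname{dom}S^2\big)\oplus\mathfrak N_{ix}=\big(\mathfrak M_{-ix}\cap\operatorname{dom}S\big)\oplus\mathfrak N_{ix};$$ in particular, $\operatorname{dom}S_{ix}\cap\operatorname{dom}S_{ix}^*=\mathfrak N_{ix}$ if and only if $\operatorname{dom}S^2=\{0\}$. -/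

import Mathlib

open scoped ComplexConjugate

noncomputable section

namespace LinearPMap

variable {H : Type*} [NormedAddCommGroup H] [InnerProductSpace ℂ H]

/-- A non-negative symmetric operator: `(S f, g) = (f, S g)` and `(S f, f) ≥ 0` on `dom S`.
(By symmetry `(S f, f)` is real, so that it suffices to look at its real part.) -/
structure IsNonnegSymmetric (S : H →ₗ.[ℂ] H) : Prop where
  symm : S.IsFormalAdjoint S
  nonneg : ∀ f : S.domain, 0 ≤ (inner ℂ (f : H) (S f)).re

/-- The operator `T - w I`, with domain `dom T`. -/
def subScalar (T : H →ₗ.[ℂ] H) (w : ℂ) : H →ₗ.[ℂ] H where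
  domain := T.domain
  toFun := T.toFun - w • T.domain.subtype

/-- The subspace `𝔐_w = ran (S - w I)`. -/
def rangeSub (S : H →ₗ.[ℂ] H) (w : ℂ) : Submodule ℂ H :=
  LinearMap.range (S.subScalar w).toFun

/-- The defect subspace `𝔑_z`, the orthogonal complement of `𝔐_{z̄} = ran (S - z̄ I)`. -/
abbrev defect (S : H →ₗ.[ℂ] H) (z : ℂ) : Submodule ℂ H :=
  (S.rangeSub (conj z))ᗮ

open scoped Classical in
/-- The operator `S_z` with domain the direct sum of `dom S` and `𝔑_z`, acting as
`S_z (f + φ) = S f - z φ` for `f ∈ dom S` and `φ ∈ 𝔑_z`. It makes sense when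
`dom S ∩ 𝔑_z = {0}`, which holds for non-negative symmetric `S` and `Re z ≤ 0`, `z ≠ 0`
(see `disjoint_domain_defect`); the value in the other case is never used. -/
def defectExt (S : H →ₗ.[ℂ] H) (z : ℂ) : H →ₗ.[ℂ] H :=
  if h : Disjoint S.domain (S.defect z) then
    S.sup ((-z • (LinearMap.id : H →ₗ[ℂ] H)).toPMap (S.defect z))
      (LinearPMap.sup_h_of_disjoint _ _ h)
  else ⊥

/-- The subspace `T (K ∩ dom T)`, the image of `K` under the operator `T`. -/
def imageOf (T : H →ₗ.[ℂ] H) (K : Submodule ℂ H) : Submodule ℂ H :=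
  (K.comap T.domain.subtype).map T.toFun

/-- The domain of the square: `dom S² = {f ∈ dom S : S f ∈ dom S}`. -/
def domSq (S : H →ₗ.[ℂ] H) : Submodule ℂ H :=
  (S.domain.comap S.toFun).map S.domain.subtype

/-- The compression `P_K (T restricted to dom T ∩ K)`, an operator in the Hilbert space `K`. -/
def compression (T : H →ₗ.[ℂ] H) (K : Submodule ℂ H) [K.HasOrthogonalProjection] :
    K →ₗ.[ℂ] K where
  domain := T.domain.comap K.subtype
  toFun := (K.orthogonalProjectionOnto : H →ₗ[ℂ] K) ∘ₗ T.toFun ∘ₗ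
    (K.subtype.restrict (p := T.domain.comap K.subtype) (q := T.domain) fun _ hx => hx)

/-- Accretive operators: the numerical range lies in the closed right half-plane. -/
def IsAccretive (T : H →ₗ.[ℂ] H) : Prop :=
  ∀ u : T.domain, 0 ≤ (inner ℂ (u : H) (T u)).re

/-- `m`-accretive operators: accretive, densely defined and `ran (T - w I) = H` for some `w` in
the open left half-plane. -/
def IsMAccretive (T : H →ₗ.[ℂ] H) : Prop :=
  T.IsAccretive ∧ Dense (T.domain : Set H) ∧ ∃ w : ℂ, w.re < 0 ∧ T.rangeSub w = ⊤

theorem mem_rangeSub {S : H →ₗ.[ℂ] H} {w : ℂ} {y : H} :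
    y ∈ S.rangeSub w ↔ ∃ f : S.domain, S f - w • (f : H) = y :=
  Iff.rfl

theorem mem_defect {S : H →ₗ.[ℂ] H} {z : ℂ} {y : H} :
    y ∈ S.defect z ↔ ∀ f : S.domain, inner ℂ (S f) y = z * inner ℂ (f : H) y := by
  rw [Submodule.mem_orthogonal]
  constructor
  · intro h f
    have := h _ (mem_rangeSub.2 ⟨f, rfl⟩)
    rw [inner_sub_left, inner_smul_left, Complex.conj_conj] at this
    exact sub_eq_zero.1 this
  · rintro h _ ⟨f, rfl⟩
    change inner ℂ (S f - conj z • (f : H)) y = 0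
    rw [inner_sub_left, inner_smul_left, Complex.conj_conj, h f, sub_self]

/-- `𝔑_z = ker (S* - z I)` for densely defined `S`. -/
theorem mem_defect_iff_adjoint [CompleteSpace H] {S : H →ₗ.[ℂ] H}
    (hd : Dense (S.domain : Set H)) {z : ℂ} {y : H} :
    y ∈ S.defect z ↔ ∃ h : y ∈ S.adjoint.domain, S.adjoint ⟨y, h⟩ = z • y := by
  rw [mem_defect]
  have key : ∀ f : S.domain, inner ℂ (S f) y = z * inner ℂ (f : H) y ↔
      inner ℂ (z • y) (f : H) = inner ℂ y (S f) := by
    intro f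
    rw [← inner_conj_symm (S f) y, ← inner_conj_symm (f : H) y, inner_smul_left]
    constructor
    · intro h
      have := congrArg conj h
      simpa using this.symm
    · intro h
      have := congrArg conj h
      simpa using this.symm
  constructor
  · intro h
    exact ⟨mem_adjoint_domain_of_exists _ ⟨z • y, fun f => (key f).1 (h f)⟩,
      adjoint_apply_eq hd _ fun f => (key f).1 (h f)⟩
  · rintro ⟨h, e⟩ f
    rw [key, ← e]
    exact adjoint_isFormalAdjoint hd ⟨y, h⟩ f

theorem disjoint_domain_defect {S : H →ₗ.[ℂ] H} (hS : S.IsNonnegSymmetric) {z : ℂ}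
    (hz : z.re ≤ 0) (hz0 : z ≠ 0) : Disjoint S.domain (S.defect z) := by
  rw [Submodule.disjoint_def]
  intro y hy hy'
  have h1 := mem_defect.1 hy' ⟨y, hy⟩
  have h2 := hS.symm ⟨y, hy⟩ ⟨y, hy⟩
  have h3 := hS.nonneg ⟨y, hy⟩
  have h4 := inner_conj_symm (𝕜 := ℂ) y (S ⟨y, hy⟩)
  simp only at h1 h2 h3 h4
  rw [← h2, h1] at h4
  rw [← h2, h1] at h3
  rw [inner_self_eq_norm_sq_to_K] at h3 h4
  by_contra hne
  have hpos : 0 < ‖y‖ ^ 2 := by positivity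
  have him := congrArg Complex.im h4
  have e : ((‖y‖ : ℂ)) ^ 2 = ((‖y‖ ^ 2 : ℝ) : ℂ) := by push_cast; rfl
  simp only [Complex.coe_algebraMap, e] at h3 him
  rw [Complex.conj_im, Complex.im_mul_ofReal] at him
  rw [Complex.re_mul_ofReal] at h3
  apply hz0
  apply Complex.ext
  · simp only [Complex.zero_re]
    nlinarith
  · simp only [Complex.zero_im]
    have : z.im * ‖y‖ ^ 2 = 0 := by linarith
    rcases mul_eq_zero.1 this with h | h
    · exact h
    · exact absurd h hpos.ne'

theorem defectExt_domain {S : H →ₗ.[ℂ] H} (hS : S.IsNonnegSymmetric) {z : ℂ}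
    (hz : z.re ≤ 0) (hz0 : z ≠ 0) : (S.defectExt z).domain = S.domain ⊔ S.defect z := by
  rw [defectExt, dif_pos (disjoint_domain_defect hS hz hz0)]
  rfl

theorem defectExt_apply {S : H →ₗ.[ℂ] H} (hS : S.IsNonnegSymmetric) {z : ℂ}
    (hz : z.re ≤ 0) (hz0 : z ≠ 0) (f : S.domain) (φ : S.defect z)
    (g : (S.defectExt z).domain) (hg : (g : H) = f + φ) :
    S.defectExt z g = S f - z • (φ : H) := by
  have hd := disjoint_domain_defect hS hz hz0
  have key : ∀ T : H →ₗ.[ℂ] H,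
      T = S.sup ((-z • (LinearMap.id : H →ₗ[ℂ] H)).toPMap (S.defect z))
        (LinearPMap.sup_h_of_disjoint _ _ hd) →
      ∀ g : T.domain, (g : H) = f + φ → T g = S f - z • (φ : H) := by
    rintro _ rfl g hg
    rw [LinearPMap.sup_apply _ f φ g hg.symm]
    simp [sub_eq_add_neg]
  exact key _ (by rw [defectExt, dif_pos hd]) g hg

end LinearPMap

end

namespace LinearPMap

variable {H : Type*} [NormedAddCommGroup H] [InnerProductSpace ℂ H]

/-! Write `M` for `𝔐_{z̄}` and `N = Mᗮ` for `𝔑_z`. Everything rests on a description of `S_z*`: a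
vector `g` lies in its domain, with value `y`, iff `y = S* g` and `y + z̄ g ∈ M`
(`forall_inner_defectExt_iff`). For `g = f + φ` with `f ∈ dom S`, `φ ∈ N`, one has `S* g = S f + z
φ`, and `y + z̄ g = (S - z̄) f + 2 (z̄ f + Re z φ)`. Hence `f + φ ∈ dom S_z*` iff `z̄ f + Re z φ ∈
M` (`add_mem_adjoint_defectExt_domain`).

The three cases read off this criterion. If `Re z < 0`, projecting onto `N` forces `φ = -(z̄ / Re z)
P_N f`. If `z = a` is real, it says `f + φ ∈ M`. If `Re z = 0`, it says `f ∈ M` and leaves `φ` free.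

Closedness of `M` comes from lower bounds on `S - w` for `Re w ≤ 0`. The range condition for
m-accretivity comes from inverting a coercive bounded operator, and selfadjointness of `T_a` from
symmetry together with `ran (T_a - a) = M`. -/

theorem inner_apply_comm {S : H →ₗ.[ℂ] H} (hS : S.IsNonnegSymmetric) (f : S.domain) :
    inner ℂ (S f) (f : H) = inner ℂ (f : H) (S f) :=
  hS.symm f f

theorem im_inner_apply {S : H →ₗ.[ℂ] H} (hS : S.IsNonnegSymmetric) (f : S.domain) :
    (inner ℂ (f : H) (S f)).im = 0 := by
  have h := congrArg Complex.im (inner_conj_symm (𝕜 := ℂ) (f : H) (S f))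
  rw [inner_apply_comm hS, Complex.conj_im] at h
  linarith

/-! ### Lower bounds for `S - w` with `Re w ≤ 0`, and their consequences. -/

theorem norm_sq_apply_sub_smul {S : H →ₗ.[ℂ] H} (hS : S.IsNonnegSymmetric) (w : ℂ)
    (f : S.domain) :
    ‖S f - w • (f : H)‖ ^ 2 =
      ‖S f‖ ^ 2 + ‖w‖ ^ 2 * ‖(f : H)‖ ^ 2 - 2 * w.re * (inner ℂ (f : H) (S f)).re := by
  rw [norm_sub_sq (𝕜 := ℂ), inner_smul_right, inner_apply_comm hS, norm_smul]
  simp only [RCLike.re_to_complex, Complex.mul_re, im_inner_apply hS]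
  ring

theorem le_norm_sq_apply_sub_smul {S : H →ₗ.[ℂ] H} (hS : S.IsNonnegSymmetric) {w : ℂ}
    (hw : w.re ≤ 0) (f : S.domain) :
    ‖S f‖ ^ 2 + ‖w‖ ^ 2 * ‖(f : H)‖ ^ 2 ≤ ‖S f - w • (f : H)‖ ^ 2 := by
  rw [norm_sq_apply_sub_smul hS]
  nlinarith [hS.nonneg f]

theorem norm_apply_le {S : H →ₗ.[ℂ] H} (hS : S.IsNonnegSymmetric) {w : ℂ}
    (hw : w.re ≤ 0) (f : S.domain) : ‖S f‖ ≤ ‖S f - w • (f : H)‖ := by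
  refine le_of_sq_le_sq ?_ (norm_nonneg _)
  nlinarith [le_norm_sq_apply_sub_smul hS hw f, sq_nonneg (‖w‖ * ‖(f : H)‖)]

theorem norm_mul_norm_le {S : H →ₗ.[ℂ] H} (hS : S.IsNonnegSymmetric) {w : ℂ}
    (hw : w.re ≤ 0) (f : S.domain) : ‖w‖ * ‖(f : H)‖ ≤ ‖S f - w • (f : H)‖ := by
  refine le_of_sq_le_sq ?_ (norm_nonneg _)
  nlinarith [le_norm_sq_apply_sub_smul hS hw f, sq_nonneg ‖S f‖]

theorem eq_zero_of_apply_sub_smul_eq_zero {S : H →ₗ.[ℂ] H} (hS : S.IsNonnegSymmetric) {w : ℂ}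
    (hw : w.re ≤ 0) (hw0 : w ≠ 0) {f : S.domain} (hf : S f - w • (f : H) = 0) : (f : H) = 0 := by
  have h := norm_mul_norm_le hS hw f
  rw [hf, norm_zero] at h
  have hw' : 0 < ‖w‖ := norm_pos_iff.2 hw0
  exact norm_eq_zero.1 (le_antisymm (nonpos_of_mul_nonpos_right h hw') (norm_nonneg _))

/-- The range is the image of the complete graph of `S` under `(f, S f) ↦ S f - w f`, which is
bounded below. -/
theorem isClosed_rangeSub [CompleteSpace H] {S : H →ₗ.[ℂ] H} (hclosed : S.IsClosed)
    (hS : S.IsNonnegSymmetric) {w : ℂ} (hw : w.re ≤ 0) (hw0 : w ≠ 0) :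
    _root_.IsClosed (S.rangeSub w : Set H) := by
  have hw' : 0 < ‖w‖ := norm_pos_iff.2 hw0
  have : CompleteSpace S.graph := hclosed.completeSpace_coe
  let L : S.graph →L[ℂ] H :=
    (ContinuousLinearMap.snd ℂ H H - w • ContinuousLinearMap.fst ℂ H H) ∘L S.graph.subtypeL
  -- In the sup norm on the graph, `1` handles the component `S f` and `‖w‖⁻¹` the component `f`.
  have hL : AntilipschitzWith (1 + ‖w‖₊⁻¹) L := by
    refine L.antilipschitz_of_bound ?_
    rintro ⟨p, hp⟩
    obtain ⟨f, hf1, hf2⟩ := (mem_graph_iff S).1 hp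
    have e : L ⟨p, hp⟩ = S f - w • (f : H) := by simp [L, hf1, hf2]
    rw [e]
    change ‖p‖ ≤ (1 + ‖w‖⁻¹) * _
    have h1 := norm_apply_le hS hw f
    have h2 := norm_mul_norm_le hS hw f
    rw [← le_inv_mul_iff₀ hw'] at h2
    have h3 : 0 ≤ ‖w‖⁻¹ * ‖S f - w • (f : H)‖ := by positivity
    rw [Prod.norm_def, ← hf1, ← hf2]
    refine max_le ?_ ?_ <;> nlinarith [norm_nonneg (S f - w • (f : H))]
  have hr : (S.rangeSub w : Set H) = Set.range L := by
    ext y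
    rw [SetLike.mem_coe, mem_rangeSub]
    constructor
    · rintro ⟨f, rfl⟩
      exact ⟨⟨((f : H), S f), mem_graph S f⟩, rfl⟩
    · rintro ⟨⟨p, hp⟩, rfl⟩
      obtain ⟨f, hf1, hf2⟩ := (mem_graph_iff S).1 hp
      exact ⟨f, by simp [L, hf1, hf2]⟩
  rw [hr]
  exact hL.isClosed_range L.uniformContinuous

theorem exists_continuous_inverse {S : H →ₗ.[ℂ] H} (hS : S.IsNonnegSymmetric) {w : ℂ}
    (hw : w.re ≤ 0) (hw0 : w ≠ 0) :
    ∃ R : S.rangeSub w →L[ℂ] H, ∀ m, ∃ f : S.domain, R m = f ∧ S f - w • (f : H) = m := by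
  have hw' : 0 < ‖w‖ := norm_pos_iff.2 hw0
  have hinj : Function.Injective (S.subScalar w).toFun := by
    rw [injective_iff_map_eq_zero]
    intro f hf
    exact Subtype.ext (eq_zero_of_apply_sub_smul_eq_zero hS hw hw0 (f := f) hf)
  let e := LinearEquiv.ofInjective (S.subScalar w).toFun hinj
  have he : ∀ m : S.rangeSub w, ∃ f : S.domain,
      ((S.domain.subtype ∘ₗ e.symm.toLinearMap) m : H) = f ∧ S f - w • (f : H) = m :=
    fun m => ⟨e.symm m, rfl, LinearEquiv.ofInjective_symm_apply (S.subScalar w).toFun m⟩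
  refine ⟨(S.domain.subtype ∘ₗ e.symm.toLinearMap).mkContinuous ‖w‖⁻¹ fun m => ?_, he⟩
  obtain ⟨f, h1, h2⟩ := he m
  rw [h1, le_inv_mul_iff₀ hw']
  refine (norm_mul_norm_le hS hw f).trans_eq ?_
  rw [h2]
  rfl

/-- A densely defined symmetric operator `T` with `ran (T - a I)` the whole space for some real
`a` is selfadjoint. -/
theorem isSelfAdjoint_of_rangeSub_eq_top [CompleteSpace H] {T : H →ₗ.[ℂ] H}
    (hd : Dense (T.domain : Set H)) (hT : T.IsFormalAdjoint T) {a : ℝ}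
    (ha : T.rangeSub (a : ℂ) = ⊤) : IsSelfAdjoint T := by
  rw [isSelfAdjoint_def]
  have hle : T ≤ T.adjoint := hT.le_adjoint hd
  refine (eq_of_le_of_domain_eq hle (le_antisymm hle.1 fun v hv => ?_)).symm
  obtain ⟨u, hu⟩ := mem_rangeSub.1 (ha ▸ Submodule.mem_top :
    T.adjoint ⟨v, hv⟩ - (a : ℂ) • v ∈ T.rangeSub (a : ℂ))
  suffices h : v - u = 0 by
    rw [sub_eq_zero.1 h]
    exact u.2
  -- Since `T* v - a v = (T - a) u` and `T ⊆ T*`, the difference `v - u` lies in `ker (T* - a) = ran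
  -- (T - a)ᗮ = 0`.
  have hdef : v - u ∈ T.defect (a : ℂ) := by
    rw [mem_defect]
    intro f
    have h1 := (adjoint_isFormalAdjoint hd).symm f ⟨v, hv⟩
    have h2 := hT f u
    rw [eq_add_of_sub_eq hu.symm, inner_add_right, inner_sub_right, inner_smul_right,
      inner_smul_right] at h1
    rw [inner_sub_right, inner_sub_right, h1, h2]
    ring
  rw [defect, Complex.conj_ofReal, ha, Submodule.top_orthogonal_eq_bot] at hdef
  exact hdef

/-! ### The extension `S_z`: accretivity, the range condition and the adjoint. -/

section DefectExt

variable {S : H →ₗ.[ℂ] H} {z : ℂ}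

theorem le_defectExt (hS : S.IsNonnegSymmetric) (hz : z.re ≤ 0) (hz0 : z ≠ 0) :
    S ≤ S.defectExt z := by
  rw [defectExt, dif_pos (disjoint_domain_defect hS hz hz0)]
  exact LinearPMap.left_le_sup _ _ _

theorem mem_defectExt_domain (hS : S.IsNonnegSymmetric) (hz : z.re ≤ 0) (hz0 : z ≠ 0) {u : H} :
    u ∈ (S.defectExt z).domain ↔ ∃ (f : S.domain) (φ : S.defect z), u = f + φ := by
  rw [defectExt_domain hS hz hz0, Submodule.mem_sup]
  constructor
  · rintro ⟨f, hf, φ, hφ, rfl⟩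
    exact ⟨⟨f, hf⟩, ⟨φ, hφ⟩, rfl⟩
  · rintro ⟨f, φ, rfl⟩
    exact ⟨f, f.2, φ, φ.2, rfl⟩

theorem inner_defect_apply (φ : S.defect z) (f : S.domain) :
    inner ℂ (φ : H) (S f) = conj z * inner ℂ (φ : H) (f : H) := by
  rw [← inner_conj_symm, mem_defect.1 φ.2 f, map_mul, inner_conj_symm]

theorem inner_add_defect_apply (hS : S.IsNonnegSymmetric) (f : S.domain) (φ : S.defect z)
    (f' : S.domain) :
    inner ℂ (S f + z • (φ : H)) (f' : H) = inner ℂ ((f : H) + φ) (S f') := by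
  rw [inner_add_left, inner_add_left, inner_smul_left, inner_defect_apply, hS.symm f f']

theorem add_conj_smul_mem_rangeSub_iff (f : S.domain) (φ : S.defect z) :
    S f + z • (φ : H) + conj z • ((f : H) + φ) ∈ S.rangeSub (conj z) ↔
      conj z • (f : H) + (z.re : ℂ) • (φ : H) ∈ S.rangeSub (conj z) := by
  have e : S f + z • (φ : H) + conj z • ((f : H) + φ) =
      (S f - conj z • (f : H)) + (2 : ℂ) • (conj z • (f : H) + (z.re : ℂ) • (φ : H)) := by
    have : (2 : ℂ) * (z.re : ℂ) = z + conj z := by rw [Complex.add_conj]; push_cast; rfl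
    rw [smul_add (2 : ℂ), smul_smul 2 (z.re : ℂ), this]
    module
  rw [e, Submodule.add_mem_iff_right _ (mem_rangeSub.2 ⟨f, rfl⟩),
    Submodule.smul_mem_iff _ two_ne_zero]

/-- The cross terms are `z̄ (φ, f)` and `-z (f, φ)`; they are negatives of each other's conjugates,
so their real parts cancel. -/
theorem re_inner_defectExt (f : S.domain) (φ : S.defect z) :
    (inner ℂ ((f : H) + φ) (S f - z • (φ : H))).re =
      (inner ℂ (f : H) (S f)).re - z.re * ‖(φ : H)‖ ^ 2 := by
  have h : (inner ℂ (φ : H) (φ : H) : ℂ) = ((‖(φ : H)‖ ^ 2 : ℝ) : ℂ) := by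
    rw [inner_self_eq_norm_sq_to_K]
    push_cast
    rfl
  rw [inner_add_left, inner_sub_right, inner_sub_right, inner_smul_right, inner_smul_right,
    inner_defect_apply, h, ← inner_conj_symm (f : H) (φ : H)]
  simp only [Complex.add_re, Complex.sub_re, Complex.mul_re, Complex.conj_re, Complex.conj_im,
    Complex.ofReal_re, Complex.ofReal_im]
  ring

theorem isAccretive_defectExt (hS : S.IsNonnegSymmetric) (hz : z.re ≤ 0) (hz0 : z ≠ 0) :
    (S.defectExt z).IsAccretive := by
  rintro ⟨u, hu⟩
  obtain ⟨f, φ, rfl⟩ := (mem_defectExt_domain hS hz hz0).1 hu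
  rw [defectExt_apply hS hz hz0 f φ _ rfl]
  change 0 ≤ (inner ℂ ((f : H) + φ) (S f - z • (φ : H))).re
  rw [re_inner_defectExt]
  nlinarith [hS.nonneg f, sq_nonneg ‖(φ : H)‖]

theorem dense_defectExt_domain (hdense : Dense (S.domain : Set H)) (hS : S.IsNonnegSymmetric)
    (hz : z.re ≤ 0) (hz0 : z ≠ 0) : Dense ((S.defectExt z).domain : Set H) :=
  hdense.mono (le_defectExt hS hz hz0).1

variable [CompleteSpace H]

theorem completeSpace_rangeSub_conj (hclosed : S.IsClosed) (hS : S.IsNonnegSymmetric)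
    (hz : z.re ≤ 0) (hz0 : z ≠ 0) : CompleteSpace (S.rangeSub (conj z)) :=
  (isClosed_rangeSub hclosed hS (w := conj z) (by simpa using hz)
    (by simpa using hz0)).completeSpace_coe

/-- The shift `z̄ - 1` nearly decouples the equation: `(S_z - z̄ + 1)(f + φ) = (S - z̄) f + f - (2
Re z - 1) φ`. Its `M`-part involves `f` only, and its `N`-part then determines `φ`. Without the
`-1`, the coefficient of `φ` would vanish for imaginary `z`. -/
theorem rangeSub_defectExt_eq_top (hclosed : S.IsClosed) (hS : S.IsNonnegSymmetric)
    (hz : z.re ≤ 0) (hz0 : z ≠ 0) : (S.defectExt z).rangeSub (conj z - 1) = ⊤ := by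
  have := completeSpace_rangeSub_conj hclosed hS hz hz0
  have hz' : (conj z).re ≤ 0 := by simpa using hz
  set M := S.rangeSub (conj z)
  obtain ⟨R, hR⟩ : ∃ R : M →L[ℂ] H, ∀ m, ∃ f : S.domain, R m = f ∧ S f - conj z • (f : H) = m :=
    exists_continuous_inverse hS hz' (by simpa using hz0)
  -- With `R = (S - z̄)⁻¹` on `M`, solving `A g = h` and putting `f = R P_M g` solves the `M`-part
  -- `(S - z̄) f + P_M f = P_M h`. `A` is invertible because `Re (P_M f, h) = (f, S f) - Re z ‖f‖² ≥
  -- 0` when `f = R P_M h`.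
  let A : H →L[ℂ] H :=
    ContinuousLinearMap.id ℂ H + M.starProjection ∘L R ∘L M.orthogonalProjectionOnto
  have hA : Function.Surjective A := by
    refine (ContinuousLinearMap.isUnit_iff_bijective.1
      (A.isUnit_of_forall_le_norm_inner_map zero_lt_one fun h => ?_)).2
    obtain ⟨f, h1, h2⟩ := hR (M.orthogonalProjectionOnto h)
    have hAh : A h = h + M.starProjection f := by simp [A, h1]
    have hre : 0 ≤ (inner ℂ (M.starProjection (f : H)) h).re := by
      rw [Submodule.inner_starProjection_left_eq_right]
      change 0 ≤ (inner ℂ (f : H) ((M.orthogonalProjectionOnto h : M) : H)).re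
      rw [← h2, inner_sub_right, inner_smul_right, inner_self_eq_norm_sq_to_K]
      have e : ((‖(f : H)‖ : ℂ)) ^ 2 = ((‖(f : H)‖ ^ 2 : ℝ) : ℂ) := by push_cast; rfl
      simp only [Complex.coe_algebraMap, e, Complex.sub_re, Complex.re_mul_ofReal]
      nlinarith [hS.nonneg f, sq_nonneg ‖(f : H)‖]
    have hself : (inner ℂ h h : ℂ).re = ‖h‖ ^ 2 := inner_self_eq_norm_sq (𝕜 := ℂ) h
    refine le_trans ?_ (Complex.re_le_norm _)
    rw [hAh, inner_add_left, Complex.add_re, hself]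
    simpa using hre
  rw [eq_top_iff]
  rintro h -
  obtain ⟨g, hg⟩ := hA h
  obtain ⟨f, h1, h2⟩ := hR (M.orthogonalProjectionOnto g)
  have hc : z + conj z - 1 ≠ 0 := by
    intro h0
    have := congrArg Complex.re h0
    simp at this
    linarith
  have hAg : g + M.starProjection (f : H) = h := by rw [← hg]; simp [A, h1]
  -- Solution of the `N`-part `P_N f - (2 Re z - 1) φ = P_N h`.
  have hφ : (z + conj z - 1)⁻¹ • (Mᗮ.starProjection (f : H) - Mᗮ.starProjection h) ∈
      S.defect z :=
    Submodule.smul_mem _ _ (Submodule.sub_mem _ (Submodule.starProjection_apply_mem _ _)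
      (Submodule.starProjection_apply_mem _ _))
  set φ : S.defect z := ⟨_, hφ⟩ with hφdef
  have hφ' : (z + conj z - 1) • (φ : H) =
      Mᗮ.starProjection (f : H) - Mᗮ.starProjection h := by
    rw [hφdef, smul_inv_smul₀ hc]
  have hf := M.starProjection_add_starProjection_orthogonal (f : H)
  have hh := M.starProjection_add_starProjection_orthogonal h
  have hPg : M.starProjection g + M.starProjection (f : H) = M.starProjection h := by
    rw [← hAg, ContinuousLinearMap.map_add]
    congr 1
    exact (Submodule.starProjection_eq_self_iff.2 (M.starProjection_apply_mem _)).symm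
  have h2' : S f - conj z • (f : H) = M.starProjection g := h2
  refine mem_rangeSub.2 ⟨⟨f + φ, (mem_defectExt_domain hS hz hz0).2 ⟨f, φ, rfl⟩⟩, ?_⟩
  rw [defectExt_apply hS hz hz0 f φ _ rfl]
  change S f - z • (φ : H) - (conj z - 1) • ((f : H) + φ) = h
  calc S f - z • (φ : H) - (conj z - 1) • ((f : H) + φ)
      = (S f - conj z • (f : H)) + f - (z + conj z - 1) • (φ : H) := by module
    _ = h := by
      rw [h2', hφ', eq_sub_of_add_eq hPg]
      nth_rewrite 2 [← hf]
      nth_rewrite 3 [← hh]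
      abel

theorem isMAccretive_defectExt (hclosed : S.IsClosed) (hdense : Dense (S.domain : Set H))
    (hS : S.IsNonnegSymmetric) (hz : z.re ≤ 0) (hz0 : z ≠ 0) : (S.defectExt z).IsMAccretive :=
  ⟨isAccretive_defectExt hS hz hz0, dense_defectExt_domain hdense hS hz hz0, conj z - 1,
    by simp; linarith, rangeSub_defectExt_eq_top hclosed hS hz hz0⟩

/-- `S_z*` is the restriction of `S*` to those `g` for which `(S* + z̄ I) g ∈ 𝔐_{z̄}`. -/
theorem forall_inner_defectExt_iff (hclosed : S.IsClosed) (hS : S.IsNonnegSymmetric)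
    (hz : z.re ≤ 0) (hz0 : z ≠ 0) {g y : H} :
    (∀ u : (S.defectExt z).domain, inner ℂ y (u : H) = inner ℂ g (S.defectExt z u)) ↔
      (∀ f : S.domain, inner ℂ y (f : H) = inner ℂ g (S f)) ∧
        y + conj z • g ∈ S.rangeSub (conj z) := by
  have := completeSpace_rangeSub_conj hclosed hS hz hz0
  -- As `M` is closed, `M = Nᗮ`; membership in `M` becomes the adjoint identity tested on `N`.
  rw [← (S.rangeSub (conj z)).orthogonal_orthogonal, Submodule.mem_orthogonal']
  constructor
  · intro h
    refine ⟨fun f => ?_, fun φ hφ => ?_⟩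
    · rw [h ⟨f, (le_defectExt hS hz hz0).1 f.2⟩,
        defectExt_apply hS hz hz0 f 0 _ (by simp)]
      simp
    · have h1 := h ⟨φ, (mem_defectExt_domain hS hz hz0).2 ⟨0, ⟨φ, hφ⟩, by simp⟩⟩
      rw [defectExt_apply hS hz hz0 0 ⟨φ, hφ⟩ _ (by simp)] at h1
      rw [inner_add_left, inner_smul_left, Complex.conj_conj, h1]
      simp [inner_smul_right]
  · rintro ⟨h1, h2⟩ ⟨u, hu⟩
    obtain ⟨f, φ, rfl⟩ := (mem_defectExt_domain hS hz hz0).1 hu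
    rw [defectExt_apply hS hz hz0 f φ _ rfl]
    have h3 := h2 φ φ.2
    rw [inner_add_left, inner_smul_left, Complex.conj_conj] at h3
    rw [inner_add_right, h1, inner_sub_right, inner_smul_right, eq_neg_of_add_eq_zero_left h3,
      sub_eq_add_neg]

theorem mem_adjoint_defectExt_domain (hclosed : S.IsClosed) (hdense : Dense (S.domain : Set H))
    (hS : S.IsNonnegSymmetric) (hz : z.re ≤ 0) (hz0 : z ≠ 0) {g : H} :
    g ∈ (S.defectExt z).adjoint.domain ↔
      ∃ y, (∀ f : S.domain, inner ℂ y (f : H) = inner ℂ g (S f)) ∧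
        y + conj z • g ∈ S.rangeSub (conj z) := by
  simp only [← forall_inner_defectExt_iff hclosed hS hz hz0]
  exact ⟨fun h => ⟨_, fun u =>
    adjoint_isFormalAdjoint (dense_defectExt_domain hdense hS hz hz0) ⟨g, h⟩ u⟩,
    mem_adjoint_domain_of_exists g⟩

theorem add_mem_adjoint_defectExt_domain (hclosed : S.IsClosed)
    (hdense : Dense (S.domain : Set H)) (hS : S.IsNonnegSymmetric) (hz : z.re ≤ 0) (hz0 : z ≠ 0)
    (f : S.domain) (φ : S.defect z) :
    (f : H) + φ ∈ (S.defectExt z).adjoint.domain ↔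
      conj z • (f : H) + (z.re : ℂ) • (φ : H) ∈ S.rangeSub (conj z) := by
  rw [mem_adjoint_defectExt_domain hclosed hdense hS hz hz0, ← add_conj_smul_mem_rangeSub_iff]
  constructor
  · rintro ⟨y, h1, h2⟩
    -- Both sides represent the same functional on the dense `dom S`: they are `S* (f + φ)`.
    have : y = S f + z • (φ : H) := by
      refine hdense.eq_of_inner_left ℂ fun v hv => ?_
      exact (h1 ⟨v, hv⟩).trans (inner_add_defect_apply hS f φ ⟨v, hv⟩).symm
    rwa [← this]
  · exact fun h => ⟨_, inner_add_defect_apply hS f φ, h⟩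

theorem adjoint_defectExt_apply (hclosed : S.IsClosed)
    (hdense : Dense (S.domain : Set H)) (hS : S.IsNonnegSymmetric) (hz : z.re ≤ 0) (hz0 : z ≠ 0)
    (f : S.domain) (φ : S.defect z) (g : (S.defectExt z).adjoint.domain)
    (hg : (g : H) = f + φ) : (S.defectExt z).adjoint g = S f + z • (φ : H) := by
  refine adjoint_apply_eq (dense_defectExt_domain hdense hS hz hz0) _ ?_
  rw [forall_inner_defectExt_iff hclosed hS hz hz0, hg, add_conj_smul_mem_rangeSub_iff,
    ← add_mem_adjoint_defectExt_domain hclosed hdense hS hz hz0, ← hg]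
  exact ⟨fun f' => by rw [hg]; exact inner_add_defect_apply hS f φ f', g.2⟩

theorem mem_defectExt_domain_inf_adjoint (hclosed : S.IsClosed)
    (hdense : Dense (S.domain : Set H)) (hS : S.IsNonnegSymmetric) (hz : z.re ≤ 0) (hz0 : z ≠ 0)
    {u : H} :
    u ∈ (S.defectExt z).domain ⊓ (S.defectExt z).adjoint.domain ↔
      ∃ (f : S.domain) (φ : S.defect z), u = f + φ ∧
        conj z • (f : H) + (z.re : ℂ) • (φ : H) ∈ S.rangeSub (conj z) := by
  rw [Submodule.mem_inf, mem_defectExt_domain hS hz hz0]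
  constructor
  · rintro ⟨⟨f, φ, rfl⟩, h⟩
    exact ⟨f, φ, rfl, (add_mem_adjoint_defectExt_domain hclosed hdense hS hz hz0 f φ).1 h⟩
  · rintro ⟨f, φ, rfl, h⟩
    exact ⟨⟨f, φ, rfl⟩, (add_mem_adjoint_defectExt_domain hclosed hdense hS hz hz0 f φ).2 h⟩

end DefectExt

section Hilbert

variable [CompleteSpace H]
  {S : H →ₗ.[ℂ] H} {z : ℂ}

/-! ### The case `Re z < 0`. -/

theorem defectExt_domain_inf_adjoint_eq_map (hclosed : S.IsClosed)
    (hdense : Dense (S.domain : Set H)) (hS : S.IsNonnegSymmetric) (hz : z.re < 0)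
    [CompleteSpace (S.rangeSub (conj z))] :
    (S.defectExt z).domain ⊓ (S.defectExt z).adjoint.domain =
      S.domain.map (((z.re : ℂ) • (S.rangeSub (conj z)).starProjection +
        (Complex.I * (z.im : ℂ)) • (S.defect z).starProjection : H →L[ℂ] H) : H →ₗ[ℂ] H) := by
  have hz0 : z ≠ 0 := by rintro rfl; simp at hz
  have hr : (z.re : ℂ) ≠ 0 := by exact_mod_cast hz.ne
  have hre : (z.re : ℂ) - conj z = Complex.I * z.im := by
    apply Complex.ext <;> simp
  set M := S.rangeSub (conj z)
  ext u
  rw [mem_defectExt_domain_inf_adjoint hclosed hdense hS hz.le hz0, Submodule.mem_map]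
  have hsum (f : H) : M.starProjection f + (S.defect z).starProjection f = f :=
    M.starProjection_add_starProjection_orthogonal f
  have key (f : H) : (z.re : ℂ) • M.starProjection f +
      (Complex.I * (z.im : ℂ)) • (S.defect z).starProjection f =
        (z.re : ℂ) • f - conj z • (S.defect z).starProjection f := by
    rw [← hre]
    nth_rewrite 3 [← hsum f]
    module
  constructor
  · rintro ⟨f, φ, rfl, h⟩
    -- The operator equals `Re z - z̄ P_N` by `key`, so its value at `f / Re z` has `dom
    -- S`-component `f`.
    refine ⟨(z.re : ℂ)⁻¹ • (f : H), S.domain.smul_mem _ f.2, ?_⟩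
    have h1 : conj z • (S.defect z).starProjection (f : H) + (z.re : ℂ) • (φ : H) = 0 := by
      have h2 : (S.defect z).starProjection (conj z • (f : H) + (z.re : ℂ) • (φ : H)) = 0 :=
        Submodule.starProjection_orthogonal_apply_eq_zero h
      rwa [ContinuousLinearMap.map_add, ContinuousLinearMap.map_smul, ContinuousLinearMap.map_smul,
        Submodule.starProjection_eq_self_iff.2 φ.2] at h2
    change (z.re : ℂ) • M.starProjection ((z.re : ℂ)⁻¹ • (f : H)) +
      (Complex.I * (z.im : ℂ)) • (S.defect z).starProjection ((z.re : ℂ)⁻¹ • (f : H)) = f + φ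
    rw [key, smul_inv_smul₀ hr, ContinuousLinearMap.map_smul, smul_comm,
      eq_neg_of_add_eq_zero_left h1, smul_neg, inv_smul_smul₀ hr, sub_neg_eq_add]
  · rintro ⟨f, hf, rfl⟩
    refine ⟨⟨(z.re : ℂ) • f, S.domain.smul_mem _ hf⟩,
      ⟨-(conj z • (S.defect z).starProjection f), Submodule.neg_mem _ (Submodule.smul_mem _ _
        (Submodule.starProjection_apply_mem _ _))⟩, (key f).trans (sub_eq_add_neg _ _), ?_⟩
    have : conj z • (z.re : ℂ) • f + (z.re : ℂ) • -(conj z • (S.defect z).starProjection f) =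
        (conj z * (z.re : ℂ)) • M.starProjection f := by
      nth_rewrite 1 [← hsum f]
      module
    change conj z • (z.re : ℂ) • f + (z.re : ℂ) • -(conj z • (S.defect z).starProjection f) ∈ M
    rw [this]
    exact M.smul_mem _ (M.starProjection_apply_mem f)

/-! ### The case of real `a < 0` and the compression `T_a`. -/

section Real

variable {a : ℝ}

omit [CompleteSpace H] in
theorem defect_ofReal (S : H →ₗ.[ℂ] H) (a : ℝ) :
    S.defect (a : ℂ) = (S.rangeSub (a : ℂ))ᗮ := by
  rw [defect, Complex.conj_ofReal]

omit [CompleteSpace H] in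
theorem starProjection_sub_mem_defect [CompleteSpace (S.rangeSub (a : ℂ))] (f : H) :
    (S.rangeSub (a : ℂ)).starProjection f - f ∈ S.defect (a : ℂ) := by
  rw [defect_ofReal, ← neg_sub]
  exact Submodule.neg_mem _ (Submodule.sub_starProjection_mem_orthogonal f)

omit [CompleteSpace H] in
theorem defectExt_inf_rangeSub_eq_map (hS : S.IsNonnegSymmetric) (ha : a < 0)
    [CompleteSpace (S.rangeSub (a : ℂ))] :
    (S.defectExt a).domain ⊓ S.rangeSub (a : ℂ) =
      S.domain.map ((S.rangeSub (a : ℂ)).starProjection : H →ₗ[ℂ] H) := by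
  have hz : (a : ℂ).re ≤ 0 := ha.le
  have hz0 : (a : ℂ) ≠ 0 := by exact_mod_cast ha.ne
  ext u
  rw [Submodule.mem_inf, mem_defectExt_domain hS hz hz0, Submodule.mem_map]
  constructor
  · rintro ⟨⟨f, φ, rfl⟩, hu⟩
    have hφ : (φ : H) ∈ (S.rangeSub (a : ℂ))ᗮ := defect_ofReal S a ▸ φ.2
    refine ⟨f, f.2, ?_⟩
    have h : (S.rangeSub (a : ℂ)).starProjection ((f : H) + φ) = f + φ :=
      Submodule.starProjection_eq_self_iff.2 hu
    rwa [ContinuousLinearMap.map_add, (Submodule.starProjection_apply_eq_zero_iff _).2 hφ, add_zero] at h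
  · rintro ⟨f, hf, rfl⟩
    exact ⟨⟨⟨f, hf⟩, ⟨_, starProjection_sub_mem_defect f⟩, (add_sub_cancel _ _).symm⟩,
      Submodule.starProjection_apply_mem _ f⟩

theorem defectExt_inf_adjoint_eq_inf_rangeSub (hclosed : S.IsClosed)
    (hdense : Dense (S.domain : Set H)) (hS : S.IsNonnegSymmetric) (ha : a < 0) :
    (S.defectExt a).domain ⊓ (S.defectExt a).adjoint.domain =
      (S.defectExt a).domain ⊓ S.rangeSub (a : ℂ) := by
  have hz : (a : ℂ).re ≤ 0 := ha.le
  have hz0 : (a : ℂ) ≠ 0 := by exact_mod_cast ha.ne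
  ext u
  rw [mem_defectExt_domain_inf_adjoint hclosed hdense hS hz hz0, Submodule.mem_inf,
    mem_defectExt_domain hS hz hz0]
  simp only [Complex.conj_ofReal, Complex.ofReal_re, ← smul_add, Submodule.smul_mem_iff _ hz0]
  constructor
  · rintro ⟨f, φ, rfl, h⟩
    exact ⟨⟨f, φ, rfl⟩, h⟩
  · rintro ⟨⟨f, φ, rfl⟩, h⟩
    exact ⟨f, φ, rfl, h⟩

/-- For `g ∈ M` the condition `S* g + a g ∈ M` also gives `S* g - a g ∈ M = ran (S - a)`. Writing
this as `(S - a) f` yields `g - f ∈ ker (S* - a) = 𝔑_a`. -/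
theorem adjoint_inf_rangeSub_le_defectExt_domain (hclosed : S.IsClosed)
    (hdense : Dense (S.domain : Set H)) (hS : S.IsNonnegSymmetric) (ha : a < 0) :
    (S.defectExt a).adjoint.domain ⊓ S.rangeSub (a : ℂ) ≤ (S.defectExt a).domain := by
  have hz : (a : ℂ).re ≤ 0 := ha.le
  have hz0 : (a : ℂ) ≠ 0 := by exact_mod_cast ha.ne
  rintro g ⟨hg, hgM⟩
  obtain ⟨y, hy, hyM⟩ := (mem_adjoint_defectExt_domain hclosed hdense hS hz hz0).1 hg
  rw [Complex.conj_ofReal] at hyM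
  have hM : y - (a : ℂ) • g ∈ S.rangeSub (a : ℂ) := by
    have e : y - (a : ℂ) • g = (y + (a : ℂ) • g) - (2 * a : ℂ) • g := by module
    rw [e]
    exact Submodule.sub_mem _ hyM (Submodule.smul_mem _ _ hgM)
  obtain ⟨f, hf⟩ := mem_rangeSub.1 hM
  refine (mem_defectExt_domain hS hz hz0).2 ⟨f, ⟨g - f, mem_defect.2 fun f' => ?_⟩,
    (add_sub_cancel _ _).symm⟩
  have h1 := hy f'
  rw [← inner_conj_symm, ← inner_conj_symm g] at h1
  have h2 := (starRingEnd ℂ).injective h1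
  rw [eq_add_of_sub_eq hf.symm, inner_add_right, inner_sub_right, inner_smul_right,
    inner_smul_right] at h2
  rw [inner_sub_right, inner_sub_right, ← h2, hS.symm f' f]
  ring

theorem defectExt_inf_rangeSub_eq_adjoint_inf_rangeSub (hclosed : S.IsClosed)
    (hdense : Dense (S.domain : Set H)) (hS : S.IsNonnegSymmetric) (ha : a < 0) :
    (S.defectExt a).domain ⊓ S.rangeSub (a : ℂ) =
      (S.defectExt a).adjoint.domain ⊓ S.rangeSub (a : ℂ) :=
  le_antisymm
    (le_inf ((defectExt_inf_adjoint_eq_inf_rangeSub hclosed hdense hS ha).ge.trans inf_le_right)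
      inf_le_right)
    (le_inf (adjoint_inf_rangeSub_le_defectExt_domain hclosed hdense hS ha) inf_le_right)

omit [CompleteSpace H] in
theorem compression_apply (T : H →ₗ.[ℂ] H) (K : Submodule ℂ H) [K.HasOrthogonalProjection]
    (v : (T.compression K).domain) :
    T.compression K v = K.orthogonalProjectionOnto (T ⟨((v : K) : H), v.2⟩) :=
  rfl

omit [CompleteSpace H] in
theorem orthogonalProjectionOnto_defect [CompleteSpace (S.rangeSub (a : ℂ))]
    (φ : S.defect (a : ℂ)) : (S.rangeSub (a : ℂ)).orthogonalProjectionOnto (φ : H) = 0 := by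
  have hφ : (φ : H) ∈ (S.rangeSub (a : ℂ))ᗮ := defect_ofReal S a ▸ φ.2
  exact Submodule.orthogonalProjectionOnto_apply_of_mem_orthogonal hφ

/-- On `f + φ` the operators `S_a` and `S_a*` give `S f - a φ` and `S f + a φ`, which differ only in
`𝔑_a`; `P_M` removes this part. -/
theorem compression_defectExt_eq_compression_adjoint (hclosed : S.IsClosed)
    (hdense : Dense (S.domain : Set H)) (hS : S.IsNonnegSymmetric) (ha : a < 0)
    [CompleteSpace (S.rangeSub (a : ℂ))] :
    (S.defectExt a).compression (S.rangeSub (a : ℂ)) =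
      (S.defectExt a).adjoint.compression (S.rangeSub (a : ℂ)) := by
  have hz : (a : ℂ).re ≤ 0 := ha.le
  have hz0 : (a : ℂ) ≠ 0 := by exact_mod_cast ha.ne
  refine LinearPMap.ext ?_ fun v hv hv' => ?_
  · ext v
    have h := SetLike.ext_iff.1
      (defectExt_inf_rangeSub_eq_adjoint_inf_rangeSub hclosed hdense hS ha) (v : H)
    simp only [Submodule.mem_inf, v.2, and_true] at h
    exact h
  · obtain ⟨f, φ, hv0⟩ := (mem_defectExt_domain hS hz hz0).1 hv
    rw [compression_apply, compression_apply, defectExt_apply hS hz hz0 f φ _ hv0,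
      adjoint_defectExt_apply hclosed hdense hS hz hz0 f φ _ hv0, ContinuousLinearMap.map_sub,
      ContinuousLinearMap.map_add, ContinuousLinearMap.map_smul, orthogonalProjectionOnto_defect, smul_zero, sub_zero, add_zero]

omit [CompleteSpace H] in
theorem inner_compression_right (T : H →ₗ.[ℂ] H) (K : Submodule ℂ H) [K.HasOrthogonalProjection]
    (u : K) (v : (T.compression K).domain) :
    inner ℂ u (T.compression K v) = inner ℂ (u : H) (T ⟨((v : K) : H), v.2⟩) := by
  rw [compression_apply]
  exact Submodule.inner_orthogonalProjectionOnto_eq_of_mem_left u _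

omit [CompleteSpace H] in
theorem IsAccretive.compression {T : H →ₗ.[ℂ] H} (hT : T.IsAccretive) (K : Submodule ℂ H)
    [K.HasOrthogonalProjection] : (T.compression K).IsAccretive := fun u => by
  rw [inner_compression_right]
  exact hT ⟨((u : K) : H), u.2⟩

theorem isFormalAdjoint_compression_adjoint {T : H →ₗ.[ℂ] H} (hT : Dense (T.domain : Set H))
    (K : Submodule ℂ H) [K.HasOrthogonalProjection] :
    (T.adjoint.compression K).IsFormalAdjoint (T.compression K) := fun u v => by
  rw [inner_compression_right, ← inner_conj_symm, inner_compression_right, inner_conj_symm]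
  exact adjoint_isFormalAdjoint hT ⟨((u : K) : H), u.2⟩ ⟨((v : K) : H), v.2⟩

/-- Symmetry holds because the compressions of `S_a` and `S_a*` are formally adjoint and coincide.
-/
theorem isNonnegSymmetric_compression_defectExt (hclosed : S.IsClosed)
    (hdense : Dense (S.domain : Set H)) (hS : S.IsNonnegSymmetric) (ha : a < 0)
    [CompleteSpace (S.rangeSub (a : ℂ))] :
    ((S.defectExt a).compression (S.rangeSub (a : ℂ))).IsNonnegSymmetric := by
  have hz : (a : ℂ).re ≤ 0 := ha.le
  have hz0 : (a : ℂ) ≠ 0 := by exact_mod_cast ha.ne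
  refine ⟨?_, (isAccretive_defectExt hS hz hz0).compression _⟩
  have h := isFormalAdjoint_compression_adjoint (dense_defectExt_domain hdense hS hz hz0)
    (S.rangeSub (a : ℂ))
  rwa [← compression_defectExt_eq_compression_adjoint hclosed hdense hS ha] at h

omit [CompleteSpace H] in
theorem starProjection_mem_defectExt_domain (hS : S.IsNonnegSymmetric) (ha : a < 0)
    [CompleteSpace (S.rangeSub (a : ℂ))] (f : S.domain) :
    (S.rangeSub (a : ℂ)).starProjection (f : H) ∈ (S.defectExt a).domain :=
  (mem_defectExt_domain hS (z := a) ha.le (by exact_mod_cast ha.ne)).2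
    ⟨f, ⟨_, starProjection_sub_mem_defect (f : H)⟩, (add_sub_cancel _ _).symm⟩

omit [CompleteSpace H] in
theorem dense_compression_defectExt_domain
    (hdense : Dense (S.domain : Set H)) (hS : S.IsNonnegSymmetric) (ha : a < 0)
    [CompleteSpace (S.rangeSub (a : ℂ))] :
    Dense (((S.defectExt a).compression (S.rangeSub (a : ℂ))).domain :
      Set (S.rangeSub (a : ℂ))) := by
  have hsurj : Function.Surjective (S.rangeSub (a : ℂ)).orthogonalProjectionOnto := fun v =>
    ⟨v, Submodule.orthogonalProjectionOnto_mem_subspace_eq_self v⟩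
  refine (hsurj.denseRange.dense_image
    (S.rangeSub (a : ℂ)).orthogonalProjectionOnto.continuous hdense).mono ?_
  rintro _ ⟨f, hf, rfl⟩
  exact starProjection_mem_defectExt_domain hS ha ⟨f, hf⟩

omit [CompleteSpace H] in
-- `(T_a - a) P_M f = P_M (S - a) f = (S - a) f`, and these vectors exhaust `M`.
theorem rangeSub_compression_defectExt (hS : S.IsNonnegSymmetric) (ha : a < 0)
    [CompleteSpace (S.rangeSub (a : ℂ))] :
    ((S.defectExt a).compression (S.rangeSub (a : ℂ))).rangeSub (a : ℂ) = ⊤ := by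
  have hz : (a : ℂ).re ≤ 0 := ha.le
  have hz0 : (a : ℂ) ≠ 0 := by exact_mod_cast ha.ne
  rw [eq_top_iff]
  rintro ⟨y, hy⟩ -
  obtain ⟨f, rfl⟩ := mem_rangeSub.1 hy
  refine mem_rangeSub.2 ⟨⟨(S.rangeSub (a : ℂ)).orthogonalProjectionOnto (f : H),
    starProjection_mem_defectExt_domain hS ha f⟩, ?_⟩
  rw [compression_apply, defectExt_apply hS hz hz0 f ⟨_, starProjection_sub_mem_defect (f : H)⟩ _
    (add_sub_cancel _ _).symm, ContinuousLinearMap.map_sub, ContinuousLinearMap.map_smul,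
    orthogonalProjectionOnto_defect, smul_zero, sub_zero]
  change _ - (a : ℂ) • (S.rangeSub (a : ℂ)).orthogonalProjectionOnto (f : H) = _
  rw [← ContinuousLinearMap.map_smul, ← ContinuousLinearMap.map_sub]
  exact Submodule.orthogonalProjectionOnto_mem_subspace_eq_self
    (⟨S f - (a : ℂ) • (f : H), hy⟩ : S.rangeSub (a : ℂ))

theorem isSelfAdjoint_compression_defectExt (hclosed : S.IsClosed)
    (hdense : Dense (S.domain : Set H)) (hS : S.IsNonnegSymmetric) (ha : a < 0)
    [CompleteSpace (S.rangeSub (a : ℂ))] :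
    IsSelfAdjoint ((S.defectExt a).compression (S.rangeSub (a : ℂ))) :=
  isSelfAdjoint_of_rangeSub_eq_top (dense_compression_defectExt_domain hdense hS ha)
    (isNonnegSymmetric_compression_defectExt hclosed hdense hS ha).symm
    (rangeSub_compression_defectExt hS ha)

end Real

/-! ### The case of imaginary `z`. -/

section Imaginary

omit [CompleteSpace H] in
-- For `f ∈ dom S`, `S f - w f ∈ dom S` iff `S f ∈ dom S`.
theorem imageOf_domSq (S : H →ₗ.[ℂ] H) (w : ℂ) :
    (S.subScalar w).imageOf S.domSq = S.rangeSub w ⊓ S.domain := by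
  ext y
  constructor
  · rintro ⟨f, ⟨f', hf', e⟩, rfl⟩
    obtain rfl : f' = f := Subtype.ext e
    exact ⟨⟨f', rfl⟩, S.domain.sub_mem hf' (S.domain.smul_mem _ f'.2)⟩
  · rintro ⟨⟨f, rfl⟩, hy⟩
    refine ⟨f, ⟨f, ?_, rfl⟩, rfl⟩
    have h := S.domain.add_mem hy (S.domain.smul_mem w f.2)
    change S f - w • (f : H) + w • (f : H) ∈ S.domain at h
    rwa [sub_add_cancel] at h

theorem defectExt_domain_inf_adjoint_eq_sup (hclosed : S.IsClosed)
    (hdense : Dense (S.domain : Set H)) (hS : S.IsNonnegSymmetric) (hz : z.re = 0)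
    (hz0 : z ≠ 0) :
    (S.defectExt z).domain ⊓ (S.defectExt z).adjoint.domain =
      (S.rangeSub (conj z) ⊓ S.domain) ⊔ S.defect z := by
  have hz0' : conj z ≠ 0 := by simpa using hz0
  ext u
  rw [mem_defectExt_domain_inf_adjoint hclosed hdense hS hz.le hz0, Submodule.mem_sup]
  simp only [hz, Complex.ofReal_zero, zero_smul, add_zero, Submodule.smul_mem_iff _ hz0']
  constructor
  · rintro ⟨f, φ, rfl, h⟩
    exact ⟨f, ⟨h, f.2⟩, φ, φ.2, rfl⟩
  · rintro ⟨f, ⟨h, hf⟩, φ, hφ, rfl⟩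
    exact ⟨⟨f, hf⟩, ⟨φ, hφ⟩, rfl, h⟩

omit [CompleteSpace H] in
theorem rangeSub_inf_domain_isOrtho_defect (S : H →ₗ.[ℂ] H) (z : ℂ) :
    (S.rangeSub (conj z) ⊓ S.domain) ⟂ S.defect z :=
  (Submodule.isOrtho_orthogonal_right _).mono_left inf_le_left

omit [CompleteSpace H] in
theorem imageOf_domSq_eq_bot_iff (hS : S.IsNonnegSymmetric) {w : ℂ} (hw : w.re ≤ 0)
    (hw0 : w ≠ 0) : (S.subScalar w).imageOf S.domSq = ⊥ ↔ S.domSq = ⊥ := by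
  simp only [Submodule.eq_bot_iff]
  constructor
  · rintro h _ ⟨f, hf, rfl⟩
    exact eq_zero_of_apply_sub_smul_eq_zero hS hw hw0 (h _ ⟨f, ⟨f, hf, rfl⟩, rfl⟩)
  · rintro h _ ⟨f, hf, rfl⟩
    rw [show f = 0 from Subtype.ext (h f hf), LinearMap.map_zero]

theorem defectExt_domain_inf_adjoint_eq_defect_iff (hclosed : S.IsClosed)
    (hdense : Dense (S.domain : Set H)) (hS : S.IsNonnegSymmetric) (hz : z.re = 0)
    (hz0 : z ≠ 0) :
    (S.defectExt z).domain ⊓ (S.defectExt z).adjoint.domain = S.defect z ↔ S.domSq = ⊥ := by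
  rw [defectExt_domain_inf_adjoint_eq_sup hclosed hdense hS hz hz0,
    ← imageOf_domSq_eq_bot_iff hS (w := conj z) (by simp [hz]) (by simpa using hz0),
    imageOf_domSq, sup_eq_right]
  refine ⟨fun h => ?_, fun h => h ▸ bot_le⟩
  -- A subspace orthogonal to `𝔑_z` and contained in it is zero.
  exact le_bot_iff.1 ((rangeSub_inf_domain_isOrtho_defect S z).disjoint le_rfl h)

end Imaginary

end Hilbert

end LinearPMap

open LinearPMap in
theorem theorem5p4 {H : Type*} [NormedAddCommGroup H] [InnerProductSpace ℂ H] [CompleteSpace H]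
    (S : H →ₗ.[ℂ] H) (hclosed : S.IsClosed) (hdense : Dense (S.domain : Set H))
    (hS : S.IsNonnegSymmetric) :
    -- for all admissible `z`: `S_z` is an m-accretive extension of `S`, `𝔐_{z̄}` is closed
    (∀ z : ℂ, z.re ≤ 0 → z ≠ 0 →
      S ≤ S.defectExt z ∧ (S.defectExt z).IsMAccretive ∧
      IsClosed (S.rangeSub (starRingEnd ℂ z) : Set H)) ∧
    -- i) `Re z < 0`
    (∀ z : ℂ, z.re < 0 →
      ∃ _ : CompleteSpace (S.rangeSub (starRingEnd ℂ z)),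
        (S.defectExt z).domain ⊓ (S.defectExt z).adjoint.domain =
          S.domain.map
            (((z.re : ℂ) • (S.rangeSub (starRingEnd ℂ z)).starProjection +
              (Complex.I * (z.im : ℂ)) • (S.defect z).starProjection : H →L[ℂ] H) :
                H →ₗ[ℂ] H)) ∧
    -- ii) `z = a < 0`
    (∀ a : ℝ, a < 0 →
      ∃ _ : CompleteSpace (S.rangeSub (a : ℂ)),
        (S.defectExt a).domain ⊓ (S.defectExt a).adjoint.domain =
          S.domain.map ((S.rangeSub (a : ℂ)).starProjection : H →ₗ[ℂ] H) ∧
        S.domain.map ((S.rangeSub (a : ℂ)).starProjection : H →ₗ[ℂ] H) =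
          (S.defectExt a).domain ⊓ S.rangeSub (a : ℂ) ∧
        (S.defectExt a).domain ⊓ S.rangeSub (a : ℂ) =
          (S.defectExt a).adjoint.domain ⊓ S.rangeSub (a : ℂ) ∧
        IsSelfAdjoint ((S.defectExt a).compression (S.rangeSub (a : ℂ))) ∧
        ((S.defectExt a).compression (S.rangeSub (a : ℂ))).IsNonnegSymmetric ∧
        (S.defectExt a).compression (S.rangeSub (a : ℂ)) =
          (S.defectExt a).adjoint.compression (S.rangeSub (a : ℂ))) ∧
    -- iii) `z = i x`, `x ≠ 0`
    (∀ x : ℝ, x ≠ 0 → ∀ z : ℂ, z = Complex.I * (x : ℂ) →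
      (S.defectExt z).domain ⊓ (S.defectExt z).adjoint.domain =
        (S.subScalar (-z)).imageOf S.domSq ⊔ S.defect z ∧
      (S.subScalar (-z)).imageOf S.domSq ⟂ S.defect z ∧
      (S.defectExt z).domain ⊓ (S.defectExt z).adjoint.domain =
        (S.rangeSub (-z) ⊓ S.domain) ⊔ S.defect z ∧
      (S.rangeSub (-z) ⊓ S.domain) ⟂ S.defect z ∧
      ((S.defectExt z).domain ⊓ (S.defectExt z).adjoint.domain = S.defect z ↔
        S.domSq = ⊥)) := by
  refine ⟨fun z hz hz0 => ⟨le_defectExt hS hz hz0, isMAccretive_defectExt hclosed hdense hS hz hz0,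
      isClosed_rangeSub hclosed hS (by simpa using hz) (by simpa using hz0)⟩,
    fun z hz => ?_, fun a ha => ?_, ?_⟩
  · have := completeSpace_rangeSub_conj hclosed hS hz.le (by rintro rfl; simp at hz)
    exact ⟨this, defectExt_domain_inf_adjoint_eq_map hclosed hdense hS hz⟩
  · have : CompleteSpace (S.rangeSub (a : ℂ)) :=
      (isClosed_rangeSub hclosed hS (w := a) ha.le (by exact_mod_cast ha.ne)).completeSpace_coe
    exact ⟨this,
      (defectExt_inf_adjoint_eq_inf_rangeSub hclosed hdense hS ha).trans
        (defectExt_inf_rangeSub_eq_map hS ha),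
      (defectExt_inf_rangeSub_eq_map hS ha).symm,
      defectExt_inf_rangeSub_eq_adjoint_inf_rangeSub hclosed hdense hS ha,
      isSelfAdjoint_compression_defectExt hclosed hdense hS ha,
      isNonnegSymmetric_compression_defectExt hclosed hdense hS ha,
      compression_defectExt_eq_compression_adjoint hclosed hdense hS ha⟩
  · rintro x hx z rfl
    set z : ℂ := Complex.I * (x : ℂ) with hzx
    have hz : z.re = 0 := by simp [hzx]
    have hz0 : z ≠ 0 := mul_ne_zero Complex.I_ne_zero (by exact_mod_cast hx)
    have hconj : -z = starRingEnd ℂ z := by simp [hzx]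
    have hsup := defectExt_domain_inf_adjoint_eq_sup hclosed hdense hS hz hz0
    have hort := rangeSub_inf_domain_isOrtho_defect S z
    rw [hconj, imageOf_domSq]
    exact ⟨hsup, hort, hsup, hort,
      defectExt_domain_inf_adjoint_eq_defect_iff hclosed hdense hS hz hz0⟩
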